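/- **Theorem 2.2.** Let $0\le p<1$ and $\sigma>0$ be known. Let $U,V,Z$ be random variables such that $U$ is Bernoulli with $P(U=0)=p$ and $P(U=1)=1-p$, $V$ has a probability density $f$ on $\mathbb R$, $Z$ is standard normal, $U$ and $V$ are independent, and $Y=UV$ is independent of $Z$. Put $X=Y+\sigma Z$, let $X_1,X_2,\dots$ be i.i.d. copies of $X$, and let $\phi_f(t)=E[e^{itV}]$. Let $\phi_w:\mathbb R\to\mathbb R$ (the Fourier transform of a smoothing kernel $w$) be measurable, bounded, symmetric, and zero outside $[-1,1]$, with $\phi_w(0)=1$ and $$\phi_w(1-t)=At^{\alpha}+o(t^{\alpha})\qquad (t\downarrow 0)$$ for some constants $A\in\mathbb R$ and $\alpha\ge 0$. For $h>0$, $n\ge1$ and $x\in\mathbb R$ define $$f_{nh}(x)=\frac1{2\pi}\int_{-\infty}^{\infty}e^{-itx}\,\frac{\phi_{emp}(t)-pe^{-\sigma^2t^2/2}}{(1-p)e^{-\sigma^2t^2/2}}\,\phi_w(ht)\,dt,\qquad \phi_{emp}(t)=\frac1n\sum_{j=1}^n e^{itX_j}.$$ Assume that $\phi_f$ is integrable on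 $\mathbb R$ and that $E[X^2]<\infty$. Let $h=h_n>0$ with $h_n\to0$ as $n\to\infty$, and fix $x\in\mathbb R$. Then the integral defining $f_{nh}(x)$ converges absolutely, $f_{nh}(x)$ is real-valued with finite mean, and, as $n\to\infty$, $$\frac{\sqrt n}{h^{1+2\alpha}e^{\sigma^2/(2h^2)}}\bigl(f_{nh}(x)-E[f_{nh}(x)]\bigr)\xrightarrow{\ \mathcal D\ }N\!\left(0,\ \frac{A^2}{2\pi^2(1-p)^2}\left(\frac1{\sigma^2}\right)^{2+2\alpha}\Gamma(\alpha+1)^2\right),$$ where $N(0,0)$ denotes the point mass at $0$. In particular, the limit law depends neither on $f$ nor on $x$. -/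

import Mathlib

open MeasureTheory ProbabilityTheory Filter Topology Asymptotics

/-- The latent variables of the atomic deconvolution model: `U` is Bernoulli with
`P (U = 0) = p`, `V` has (Lebesgue) density `f`, `Z` is standard normal, `U` and `V` are
independent, and `Y = U V` is independent of `Z`. -/
structure IsAtomicModel {Ω : Type*} [MeasurableSpace Ω] (P : Measure Ω) (p : ℝ) (f : ℝ → ℝ)
    (U V Z : Ω → ℝ) : Prop where
  density_measurable : Measurable f
  density_nonneg : ∀ v, 0 ≤ f v
  law_U : HasLaw U
    (ENNReal.ofReal p • Measure.dirac (0 : ℝ) + ENNReal.ofReal (1 - p) • Measure.dirac (1 : ℝ)) P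
  law_V : HasLaw V (volume.withDensity fun v => ENNReal.ofReal (f v)) P
  law_Z : HasLaw Z (gaussianReal 0 1) P
  indep_U_V : IndepFun U V P
  indep_Y_Z : IndepFun (fun ω => U ω * V ω) Z P

/-- The conditions on the Fourier transform `φ` (real valued) of the smoothing kernel:
bounded, symmetric, supported in `[-1, 1]`, `φ 0 = 1`, and
`φ (1 - t) = A t ^ α + o (t ^ α)` as `t ↓ 0`, where `α ≥ 0`. -/
structure KernelCondition (φ : ℝ → ℝ) (A α : ℝ) : Prop where
  measurable : Measurable φ
  bounded : ∃ K : ℝ, ∀ t, |φ t| ≤ K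
  symmetric : ∀ t, φ (-t) = φ t
  support_subset : Function.support φ ⊆ Set.Icc (-1) 1
  at_zero : φ 0 = 1
  exponent_nonneg : 0 ≤ α
  expansion_at_one : (fun t : ℝ => φ (1 - t) - A * t ^ α) =o[𝓝[>] 0] (fun t : ℝ => t ^ α)

/-- The empirical characteristic function `n⁻¹ ∑ e ^ (i t X_j)` of the first `n` entries of the
data sequence `xs`. -/
noncomputable def empiricalCharFun (xs : ℕ → ℝ) (n : ℕ) (t : ℝ) : ℂ :=
  (1 / (n : ℂ)) * ∑ j ∈ Finset.range n, Complex.exp (Complex.I * t * xs j)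

/-- The integrand in the definition of the estimator:
`e ^ (- i t x) (φ_emp t - p e ^ (- σ² t² / 2)) / ((1 - p) e ^ (- σ² t² / 2)) φ (h t)`. -/
noncomputable def estimatorIntegrand (p σ : ℝ) (φ : ℝ → ℝ) (xs : ℕ → ℝ) (n : ℕ) (h x t : ℝ) : ℂ :=
  Complex.exp (-(Complex.I * t * x)) *
    ((empiricalCharFun xs n t - p * Real.exp (-(σ ^ 2 * t ^ 2) / 2)) /
      ((1 - p) * Real.exp (-(σ ^ 2 * t ^ 2) / 2))) * φ (h * t)

/-- The deconvolution kernel estimator `f_{nh} (x)` (for known `p`), as the complex number given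
by its defining integral. -/
noncomputable def deconvEstimator (p σ : ℝ) (φ : ℝ → ℝ) (xs : ℕ → ℝ) (n : ℕ) (h x : ℝ) : ℂ :=
  (1 / (2 * Real.pi)) * ∫ t : ℝ, estimatorIntegrand p σ φ xs n h x t

/-! The estimator is a deterministic term plus the average of `K_h (X_j - x)`, where `K_h` is the
cosine transform of an even weight proportional to `e ^ (σ² t² / 2) φ (h t)` (`deconvEstimator_eq`).
For small `h` this weight is concentrated at the edges `t = ±1/h` of its support. In the coordinate
`t = 1/h - h v` the exponential becomes `e ^ (σ² / (2 h²))` times approximately `e ^ (-σ² v)`, and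
`φ (1 - h² v)` is approximately `A h ^ (2α) v ^ α`. A Gamma integral in `v` remains, so `K_h y / (h
^ (1 + 2α) e ^ (σ² / (2 h²)))` is `c cos (y / h) + o(1)` with `c = A Γ(α + 1) / (π (1 - p) σ ^ (2α +
2))` (`deconvKernel_eq_edge`, `tendsto_integral_edge`).

The Gaussian component of `X` makes its characteristic function vanish at infinity. The phase `(X -
x) / h` therefore averages out: the cosine has mean tending to `0` and second moment tending to
`1/2`, whatever `f` and `x` are (`tendsto_integral_of_sub_cos`). The normalised summands are bounded
uniformly in `h`, and their variances tend to `c² / 2`. The central limit theorem for bounded row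
sums (`tendstoInDistribution_inv_sqrt_mul_sum_of_bounded`) then applies without any rate linking `h`
to `n`. -/

/-! ### Central limit theorem for bounded row sums. -/

/-- Second order Taylor bound for the characteristic function of a centred random variable bounded
by `C`, at a point `u` with `|u| * C ≤ 1`. -/
lemma norm_charFun_map_sub_le {ν : Measure ℝ} [IsProbabilityMeasure ν] {ξ : ℝ → ℝ} {C u : ℝ}
    (hξ : Measurable ξ) (hC : ∀ y, |ξ y| ≤ C) (h0 : ∫ y, ξ y ∂ν = 0) (hu : |u| * C ≤ 1) :
    ‖charFun (ν.map ξ) u - 1 + ((u ^ 2 * ∫ y, ξ y ^ 2 ∂ν) / 2 : ℝ)‖ ≤ (|u| * C) ^ 3 := by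
  have hint : Integrable ξ ν :=
    Integrable.of_bound hξ.aestronglyMeasurable C (ae_of_all _ fun y => by simpa using hC y)
  have hint2 : Integrable (fun y => ξ y ^ 2) ν :=
    Integrable.of_bound (by fun_prop) (C ^ 2) (ae_of_all _ fun y => by
      rw [Real.norm_eq_abs, abs_pow]; exact pow_le_pow_left₀ (abs_nonneg _) (hC y) 2)
  have hexp : Integrable (fun y => Complex.exp (u * ξ y * Complex.I)) ν :=
    Integrable.of_bound (by fun_prop) 1 (ae_of_all _ fun y => by
      rw [← Complex.ofReal_mul, Complex.norm_exp_ofReal_mul_I])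
  have hlin : Integrable (fun y => 1 + (u * ξ y : ℂ) * Complex.I) ν :=
    (integrable_const _).add ((hint.ofReal.const_mul _).mul_const _)
  have hquad : Integrable (fun y => ((u ^ 2 * ξ y ^ 2 / 2 : ℝ) : ℂ)) ν :=
    ((hint2.const_mul _).div_const _).ofReal
  have heq : charFun (ν.map ξ) u - 1 + ((u ^ 2 * ∫ y, ξ y ^ 2 ∂ν) / 2 : ℝ)
      = ∫ y, (Complex.exp (u * ξ y * Complex.I) - (1 + (u * ξ y : ℂ) * Complex.I)
          + ((u ^ 2 * ξ y ^ 2 / 2 : ℝ) : ℂ)) ∂ν := by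
    have hlin0 : ∫ y, (1 + (u * ξ y : ℂ) * Complex.I) ∂ν = 1 := by
      rw [integral_add (integrable_const _) ((hint.ofReal.const_mul _).mul_const _),
        integral_mul_const, integral_const_mul, integral_complex_ofReal, h0]
      simp
    have hdiff : Integrable (fun y => Complex.exp (u * ξ y * Complex.I) -
        (1 + (u * ξ y : ℂ) * Complex.I)) ν := hexp.sub hlin
    rw [integral_add hdiff hquad, integral_sub hexp hlin, hlin0,
      integral_complex_ofReal, integral_div, integral_const_mul, charFun_apply_real,
      integral_map hξ.aemeasurable (by fun_prop)]
  rw [heq]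
  refine (norm_integral_le_of_norm_le_const (C := (|u| * C) ^ 3) (ae_of_all _ fun y => ?_)).trans
    (by simp)
  have hle : ‖(u * ξ y : ℂ) * Complex.I‖ ≤ |u| * C := by
    simp only [norm_mul, Complex.norm_real, Complex.norm_I, mul_one, Real.norm_eq_abs]
    exact mul_le_mul_of_nonneg_left (hC y) (abs_nonneg u)
  -- The remainder constant is `4 / (3! * 3) = 2/9`, rounded up to `1` below.
  have hb := Complex.exp_bound (hle.trans hu) (n := 3) (by norm_num)
  have hsum : ∑ m ∈ Finset.range 3, ((u * ξ y : ℂ) * Complex.I) ^ m / (m.factorial : ℂ)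
      = 1 + (u * ξ y : ℂ) * Complex.I - ((u ^ 2 * ξ y ^ 2 / 2 : ℝ) : ℂ) := by
    simp only [Finset.sum_range_succ, Finset.sum_range_zero, mul_pow, Complex.I_sq]
    push_cast [Nat.factorial]
    ring
  rw [hsum, ← sub_add] at hb
  refine hb.trans ?_
  calc _ ≤ ‖(u * ξ y : ℂ) * Complex.I‖ ^ 3 * 1 := by
        gcongr
        norm_num [Nat.factorial]
    _ ≤ _ := by rw [mul_one]; gcongr

/-- **Central limit theorem** for row sums of uniformly bounded, centred functions of an i.i.d.
sequence, with converging variances. -/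
theorem tendstoInDistribution_inv_sqrt_mul_sum_of_bounded {Ω : Type*} [MeasurableSpace Ω]
    {P : Measure Ω} [IsProbabilityMeasure P] {ν : Measure ℝ} [IsProbabilityMeasure ν]
    {X : ℕ → Ω → ℝ} (hindep : iIndepFun X P) (hX : ∀ j, HasLaw (X j) ν P)
    {ξ : ℕ → ℝ → ℝ} {C v : ℝ} (hξ : ∀ n, Measurable (ξ n)) (hC : ∀ n y, |ξ n y| ≤ C)
    (h0 : ∀ n, ∫ y, ξ n y ∂ν = 0) (hv : Tendsto (fun n => ∫ y, ξ n y ^ 2 ∂ν) atTop (𝓝 v)) :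
    TendstoInDistribution (fun (n : ℕ) ω => (√n)⁻¹ * ∑ j ∈ Finset.range n, ξ n (X j ω)) atTop
      (id : ℝ → ℝ) (fun _ => P) (gaussianReal 0 v.toNNReal) where
  forall_aemeasurable n := .const_mul (Finset.aemeasurable_fun_sum _ fun j _ =>
    (hξ n).comp_aemeasurable (hX j).aemeasurable) _
  tendsto := by
    refine ProbabilityMeasure.tendsto_iff_tendsto_charFun.2 fun t ↦ ?_
    have hv0 : 0 ≤ v := ge_of_tendsto' hv fun n => integral_nonneg fun y => sq_nonneg _
    have hC0 : 0 ≤ C := (abs_nonneg _).trans (hC 0 0)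
    have hchar : ∀ n : ℕ,
        charFun (P.map (fun ω => (√n)⁻¹ * ∑ j ∈ Finset.range n, ξ n (X j ω))) t =
          (1 + (charFun (ν.map (ξ n)) ((√n)⁻¹ * t) - 1)) ^ n := by
      intro n
      have hm : ∀ j, AEMeasurable (fun ω => ξ n (X j ω)) P := fun j =>
        (hξ n).comp_aemeasurable (hX j).aemeasurable
      have hI : iIndepFun (fun j ω => ξ n (X j ω)) P := hindep.comp (fun _ => ξ n) fun _ => hξ n
      rw [charFun_map_mul_comp, (hI.restrict _).charFun_map_fun_finsetSum_eq_prod (fun _ _ ↦ hm _)]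
      · have : ∀ j, P.map (fun ω => ξ n (X j ω)) = ν.map (ξ n) := fun j => by
          rw [← (hX j).map_eq, AEMeasurable.map_map_of_aemeasurable (hξ n).aemeasurable
            (hX j).aemeasurable]
          rfl
        simp [this]
      · exact Finset.aemeasurable_fun_sum _ fun _ _ ↦ hm _
    have hlim : charFun ((gaussianReal 0 v.toNNReal).map id) t
        = Complex.exp ((-(t ^ 2 * v / 2) : ℝ) : ℂ) := by
      rw [Measure.map_id, charFun_gaussianReal]
      simp only [Real.coe_toNNReal v hv0]
      congr 1
      push_cast
      ring
    simp only [ProbabilityMeasure.coe_mk, hchar, hlim]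
    -- It remains to show that `n` times the deviation of the characteristic function from `1` tends
    -- to the Gaussian exponent.
    apply Complex.tendsto_one_add_pow_exp_of_tendsto
    have hsq : Tendsto (fun n : ℕ => (√(n : ℝ))⁻¹) atTop (𝓝 0) :=
      tendsto_inv_atTop_zero.comp <| Real.tendsto_sqrt_atTop.comp tendsto_natCast_atTop_atTop
    have hmain : Tendsto (fun n => ((-(t ^ 2 * ∫ y, ξ n y ^ 2 ∂ν) / 2 : ℝ) : ℂ)) atTop
        (𝓝 ((-(t ^ 2 * v / 2) : ℝ) : ℂ)) := by
      refine (Complex.continuous_ofReal.tendsto _).comp ?_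
      rw [← neg_div]
      exact ((hv.const_mul _).neg).div_const _
    refine hmain.congr_dist ?_
    -- The total Taylor error is `n (|t| C / √n)³ = (|t| C)³ / √n`.
    have hub : Tendsto (fun n : ℕ => (|t| * C) ^ 3 * (√(n : ℝ))⁻¹) atTop (𝓝 0) := by
      simpa using hsq.const_mul ((|t| * C) ^ 3)
    refine squeeze_zero' (Eventually.of_forall fun _ => dist_nonneg) ?_ hub
    have hsmall : ∀ᶠ n : ℕ in atTop, |(√(n : ℝ))⁻¹ * t| * C ≤ 1 := by
      have : Tendsto (fun n : ℕ => |(√(n : ℝ))⁻¹ * t| * C) atTop (𝓝 0) := by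
        simpa using ((hsq.mul_const t).abs).mul_const C
      exact this.eventually_le_const one_pos
    filter_upwards [hsmall, eventually_gt_atTop 0] with n hn hn0
    have hb := norm_charFun_map_sub_le (hξ n) (hC n) (h0 n) hn
    have hnpos : (0 : ℝ) < n := by exact_mod_cast hn0
    have hs : 0 < √(n : ℝ) := Real.sqrt_pos.2 hnpos
    have hss : √(n : ℝ) ^ 2 = n := Real.sq_sqrt hnpos.le
    rw [dist_comm, dist_eq_norm]
    have heq : (n : ℂ) * (charFun (ν.map (ξ n)) ((√n)⁻¹ * t) - 1)
          - ((-(t ^ 2 * ∫ y, ξ n y ^ 2 ∂ν) / 2 : ℝ) : ℂ)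
        = n * (charFun (ν.map (ξ n)) ((√n)⁻¹ * t) - 1
          + ((((√n)⁻¹ * t) ^ 2 * ∫ y, ξ n y ^ 2 ∂ν) / 2 : ℝ)) := by
      have h1 : (n : ℝ) * ((((√n)⁻¹ * t) ^ 2 * ∫ y, ξ n y ^ 2 ∂ν) / 2)
          = (t ^ 2 * ∫ y, ξ n y ^ 2 ∂ν) / 2 := by
        rw [mul_pow, inv_pow, hss]; field_simp
      rw [mul_add, ← Complex.ofReal_natCast, ← Complex.ofReal_mul, h1]
      push_cast
      ring
    rw [heq, norm_mul, Complex.norm_natCast]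
    refine (mul_le_mul_of_nonneg_left hb hnpos.le).trans_eq ?_
    rw [abs_mul, abs_of_pos (inv_pos.2 hs)]
    nth_rewrite 1 [← hss]
    field_simp

/-! ### The estimator as an average of real kernels. -/

/-- The Fourier weight `φ (h t) / ((1 - p) e ^ (- σ² t² / 2))` of the deconvolution kernel. -/
noncomputable def deconvWeight (p σ : ℝ) (φ : ℝ → ℝ) (h t : ℝ) : ℝ :=
  Real.exp (σ ^ 2 * t ^ 2 / 2) / (1 - p) * φ (h * t)

/-- The deconvolution kernel, as a real cosine transform of `deconvWeight`. -/
noncomputable def deconvKernel (p σ : ℝ) (φ : ℝ → ℝ) (h y : ℝ) : ℝ :=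
  (1 / (2 * Real.pi)) * ∫ t : ℝ, Real.cos (t * y) * deconvWeight p σ φ h t

section Kernel

variable {p σ : ℝ} {φ : ℝ → ℝ} {A α h : ℝ}

lemma KernelCondition.eq_zero (hφ : KernelCondition φ A α) {t : ℝ} (ht : 1 < |t|) : φ t = 0 := by
  by_contra hne
  have := hφ.support_subset (Function.mem_support.2 hne)
  exact absurd (abs_le.2 this) (not_le.2 ht)

lemma measurable_deconvWeight (hφ : KernelCondition φ A α) :
    Measurable (deconvWeight p σ φ h) := by
  have := hφ.measurable
  unfold deconvWeight
  fun_prop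

lemma deconvWeight_neg (hφ : KernelCondition φ A α) (t : ℝ) :
    deconvWeight p σ φ h (-t) = deconvWeight p σ φ h t := by
  simp [deconvWeight, hφ.symmetric]

lemma deconvWeight_abs (hφ : KernelCondition φ A α) (t : ℝ) :
    deconvWeight p σ φ h |t| = deconvWeight p σ φ h t := by
  rcases abs_choice t with ht | ht <;> rw [ht]
  exact deconvWeight_neg hφ t

lemma integrable_deconvWeight (hφ : KernelCondition φ A α) (hp : p < 1) (hh : 0 < h) :
    Integrable (deconvWeight p σ φ h) := by
  obtain ⟨K, hK⟩ := hφ.bounded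
  have hp' : 0 < 1 - p := sub_pos.2 hp
  have hsupp : Function.support (deconvWeight p σ φ h) ⊆ Set.Icc (-(1 / h)) (1 / h) := by
    intro t ht
    by_contra hmem
    apply ht
    have : 1 < |h * t| := by
      rw [abs_mul, abs_of_pos hh]
      by_contra hle
      exact hmem (abs_le.1 ((le_div_iff₀' hh).2 (not_lt.1 hle)))
    simp [deconvWeight, hφ.eq_zero this]
  rw [← integrableOn_iff_integrable_of_support_subset hsupp]
  refine Measure.integrableOn_of_bounded (M := Real.exp (σ ^ 2 * (1 / h) ^ 2 / 2) / (1 - p) * K)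
    (by simp) (measurable_deconvWeight hφ).aestronglyMeasurable ?_
  refine (ae_restrict_iff' measurableSet_Icc).2 (ae_of_all _ fun t ht => ?_)
  have hsq : t ^ 2 ≤ (1 / h) ^ 2 := sq_le_sq' ht.1 ht.2
  rw [deconvWeight, norm_mul, Real.norm_eq_abs, Real.norm_eq_abs,
    abs_of_pos (div_pos (Real.exp_pos _) hp')]
  have := hK (h * t)
  gcongr

lemma integrable_cos_mul_deconvWeight (hφ : KernelCondition φ A α) (hp : p < 1) (hh : 0 < h)
    (y : ℝ) : Integrable fun t => Real.cos (t * y) * deconvWeight p σ φ h t :=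
  (integrable_deconvWeight hφ hp hh).bdd_mul (c := 1) (by fun_prop)
    (ae_of_all _ fun t => Real.abs_cos_le_one _)

lemma integrable_exp_mul_deconvWeight (hφ : KernelCondition φ A α) (hp : p < 1) (hh : 0 < h)
    (y : ℝ) : Integrable fun t : ℝ => Complex.exp (Complex.I * t * y) * deconvWeight p σ φ h t :=
  (integrable_deconvWeight hφ hp hh).ofReal.bdd_mul (c := 1) (by fun_prop)
    (ae_of_all _ fun t => by
      rw [mul_assoc, mul_comm, ← Complex.ofReal_mul, Complex.norm_exp_ofReal_mul_I])

lemma continuous_deconvKernel (hφ : KernelCondition φ A α) (hp : p < 1) (hh : 0 < h) :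
    Continuous (deconvKernel p σ φ h) := by
  refine continuous_const.mul (continuous_of_dominated
    (fun y => (integrable_cos_mul_deconvWeight hφ hp hh y).aestronglyMeasurable)
    (fun y => ae_of_all _ fun t => ?_) (integrable_deconvWeight (σ := σ) hφ hp hh).norm
    (ae_of_all _ fun t => by fun_prop))
  rw [norm_mul]
  exact mul_le_of_le_one_left (norm_nonneg _) (Real.abs_cos_le_one _)

/-- The weight is even, so averaging the integrand over `t` and `-t` keeps only the cosine; this is
why the estimator is real. -/
lemma integral_exp_mul_deconvWeight (hφ : KernelCondition φ A α) (hp : p < 1) (hh : 0 < h)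
    (y : ℝ) : ∫ t : ℝ, Complex.exp (Complex.I * t * y) * deconvWeight p σ φ h t
      = ((∫ t : ℝ, Real.cos (t * y) * deconvWeight p σ φ h t : ℝ) : ℂ) := by
  set G : ℝ → ℂ := fun t => Complex.exp (Complex.I * t * y) * deconvWeight p σ φ h t with hG
  have hint : Integrable G := integrable_exp_mul_deconvWeight hφ hp hh y
  have havg : ∀ t, ((Real.cos (t * y) * deconvWeight p σ φ h t : ℝ) : ℂ)
      = (G t + G (-t)) / 2 := by
    intro t
    simp only [hG, deconvWeight_neg hφ, Complex.ofReal_mul, Complex.ofReal_cos, Complex.cos]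
    push_cast
    ring_nf
  rw [← integral_complex_ofReal]
  simp_rw [havg]
  rw [integral_div, integral_add hint hint.comp_neg, integral_neg_eq_self]
  ring

/-- In the term correcting for the atom the Gaussian factor cancels against the denominator, leaving
the weight with `σ = 0`. That term is deterministic and disappears on centring. -/
lemma estimatorIntegrand_eq (hp : p < 1) (xs : ℕ → ℝ) (n : ℕ) (x t : ℝ) :
    estimatorIntegrand p σ φ xs n h x t =
      (1 / (n : ℂ)) * ∑ j ∈ Finset.range n,
          Complex.exp (Complex.I * t * ((xs j - x : ℝ) : ℂ)) * deconvWeight p σ φ h t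
        - p * (Complex.exp (Complex.I * t * ((-x : ℝ) : ℂ)) * deconvWeight p 0 φ h t) := by
  have hp' : (1 - p : ℂ) ≠ 0 := by
    exact_mod_cast (sub_pos.2 hp).ne'
  have hw : (deconvWeight p σ φ h t : ℂ)
      = 1 / ((1 - p) * Real.exp (-(σ ^ 2 * t ^ 2) / 2)) * φ (h * t) := by
    rw [deconvWeight, neg_div, Real.exp_neg]
    push_cast
    field_simp
  have hw0 : (deconvWeight p 0 φ h t : ℂ) = 1 / (1 - p) * φ (h * t) := by
    simp [deconvWeight]
  have he : ∀ j, Complex.exp (Complex.I * t * ((xs j - x : ℝ) : ℂ))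
      = Complex.exp (-(Complex.I * t * x)) * Complex.exp (Complex.I * t * xs j) := fun j => by
    rw [← Complex.exp_add]; congr 1; push_cast; ring
  have he0 : Complex.exp (Complex.I * t * ((-x : ℝ) : ℂ)) = Complex.exp (-(Complex.I * t * x)) := by
    congr 1; push_cast; ring
  have hE : (Real.exp (-(σ ^ 2 * t ^ 2) / 2) : ℂ) ≠ 0 := by
    exact_mod_cast (Real.exp_pos _).ne'
  simp only [he, he0, hw, hw0, ← Finset.sum_mul, ← Finset.mul_sum, estimatorIntegrand,
    empiricalCharFun]
  field_simp

lemma integrable_estimatorIntegrand (hφ : KernelCondition φ A α) (hp : p < 1) (hh : 0 < h)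
    (xs : ℕ → ℝ) (n : ℕ) (x : ℝ) : Integrable (estimatorIntegrand p σ φ xs n h x) := by
  rw [funext (estimatorIntegrand_eq hp xs n x)]
  exact ((integrable_finsetSum _ fun j _ =>
    integrable_exp_mul_deconvWeight hφ hp hh _).const_mul _).sub
      ((integrable_exp_mul_deconvWeight hφ hp hh _).const_mul _)

/-- The estimator is an average of deconvolution kernels minus a deterministic term; in
particular it is real. -/
lemma deconvEstimator_eq (hφ : KernelCondition φ A α) (hp : p < 1) (hh : 0 < h)
    (xs : ℕ → ℝ) (n : ℕ) (x : ℝ) :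
    deconvEstimator p σ φ xs n h x =
      (((1 / (n : ℝ)) * ∑ j ∈ Finset.range n, deconvKernel p σ φ h (xs j - x)
        - p * deconvKernel p 0 φ h (-x) : ℝ) : ℂ) := by
  have hi := fun (τ y : ℝ) => integrable_exp_mul_deconvWeight (σ := τ) hφ hp hh y
  rw [deconvEstimator, funext (estimatorIntegrand_eq hp xs n x),
    integral_sub ((integrable_finsetSum _ fun j _ => hi _ _).const_mul _)
      ((hi _ _).const_mul _), integral_const_mul, integral_const_mul,
    integral_finsetSum _ fun j _ => hi _ _]
  simp only [integral_exp_mul_deconvWeight hφ hp hh, deconvKernel]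
  push_cast
  rw [← Finset.mul_sum]
  ring

end Kernel

/-! ### Laplace asymptotics of the kernel at the edge of its support. -/

/-- The part of the weight of the deconvolution kernel near the edge `t = 1 / h` of its support,
in the coordinate `t = 1 / h - h v` and without the factor `e ^ (σ² / (2 h²)) / (1 - p)`. -/
noncomputable def edgeWeight (σ : ℝ) (φ : ℝ → ℝ) (h v : ℝ) : ℝ :=
  if h ^ 2 * v < 1 then φ (1 - h ^ 2 * v) * Real.exp (-(σ ^ 2 * v) + σ ^ 2 * (h ^ 2 * v) * v / 2)
  else 0

section Edge

variable {p σ : ℝ} {φ : ℝ → ℝ} {A α h : ℝ}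

lemma measurable_edgeWeight (hφ : KernelCondition φ A α) : Measurable (edgeWeight σ φ h) := by
  have := hφ.measurable
  refine Measurable.ite (measurableSet_lt (by fun_prop) (by fun_prop)) ?_ measurable_const
  fun_prop

/-- Evenness reduces to `t > 0`, and the substitution `t = 1/h - h v` gives `σ² t² / 2 = σ² / (2 h²)
- σ² v + σ² h² v² / 2`. -/
lemma deconvKernel_eq_edge (hφ : KernelCondition φ A α) (hh : 0 < h) (y : ℝ) :
    deconvKernel p σ φ h y = h * Real.exp (σ ^ 2 / (2 * h ^ 2)) / (Real.pi * (1 - p)) *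
      ∫ v in Set.Ioi 0, edgeWeight σ φ h v * Real.cos ((1 - h ^ 2 * v) * (y / h)) := by
  set G : ℝ → ℝ := fun t => Real.cos (t * y) * deconvWeight p σ φ h t with hG
  have hGabs : ∀ t, G |t| = G t := fun t => by
    simp only [hG, deconvWeight_abs hφ]
    rcases abs_choice t with ht | ht <;> rw [ht]
    rw [neg_mul, Real.cos_neg]
  have h1 : ∫ t, G t = 2 * ∫ t in Set.Ioi 0, G t := by
    rw [← integral_comp_abs]
    simp_rw [hGabs]
  -- Extending by zero lets the affine substitution be made over the whole line.
  set F : ℝ → ℝ := (Set.Ioi 0).indicator G with hF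
  have h2 : ∫ t in Set.Ioi 0, G t = h * ∫ v, F (1 / h - h * v) := by
    rw [Measure.integral_comp_mul_left (fun s => F (1 / h - s)) h, integral_sub_left_eq_self,
      hF, integral_indicator measurableSet_Ioi, smul_eq_mul, abs_of_pos (inv_pos.2 hh),
      ← mul_assoc, mul_inv_cancel₀ hh.ne', one_mul]
  -- For `v < 0` the argument of `φ` exceeds `1`. The point `v = 0` must be kept since `φ 1` may be
  -- nonzero; it is a null set once integrated.
  have h3 : ∀ v, F (1 / h - h * v) = (Set.Ici 0).indicator (fun v =>
      Real.exp (σ ^ 2 / (2 * h ^ 2)) / (1 - p) *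
        (edgeWeight σ φ h v * Real.cos ((1 - h ^ 2 * v) * (y / h)))) v := by
    intro v
    have hs : h * (1 / h - h * v) = 1 - h ^ 2 * v := by field_simp
    have hiff : 0 < 1 / h - h * v ↔ h ^ 2 * v < 1 := by
      rw [← mul_pos_iff_of_pos_left hh, hs, sub_pos]
    by_cases hv : h ^ 2 * v < 1
    · rw [hF, Set.indicator_of_mem (Set.mem_Ioi.2 (hiff.2 hv))]
      by_cases hv0 : 0 ≤ v
      · rw [Set.indicator_of_mem (Set.mem_Ici.2 hv0)]
        simp only [hG, deconvWeight, edgeWeight, if_pos hv, hs]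
        have hexp : Real.exp (σ ^ 2 * (1 / h - h * v) ^ 2 / 2) = Real.exp (σ ^ 2 / (2 * h ^ 2)) *
            Real.exp (-(σ ^ 2 * v) + σ ^ 2 * (h ^ 2 * v) * v / 2) := by
          rw [← Real.exp_add]
          congr 1
          field_simp
          ring
        have hcos : (1 / h - h * v) * y = (1 - h ^ 2 * v) * (y / h) := by field_simp
        rw [hexp, hcos]
        ring
      · rw [Set.indicator_of_notMem (by simpa using hv0)]
        have : φ (1 - h ^ 2 * v) = 0 := hφ.eq_zero <| by
          have : h ^ 2 * v < 0 := mul_neg_of_pos_of_neg (by positivity) (not_le.1 hv0)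
          rw [abs_of_pos (by linarith)]
          linarith
        simp only [hG, deconvWeight, hs, this, mul_zero]
    · rw [hF, Set.indicator_of_notMem (fun hmem => hv (hiff.1 (Set.mem_Ioi.1 hmem)))]
      simp [Set.indicator_apply, edgeWeight, if_neg hv]
  have h4 : ∫ v, F (1 / h - h * v) = Real.exp (σ ^ 2 / (2 * h ^ 2)) / (1 - p) *
      ∫ v in Set.Ioi 0, edgeWeight σ φ h v * Real.cos ((1 - h ^ 2 * v) * (y / h)) := by
    simp_rw [h3]
    rw [integral_indicator measurableSet_Ici, integral_const_mul, integral_Ici_eq_integral_Ioi]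
  rw [deconvKernel, h1, h2, h4]
  have := Real.pi_pos.ne'
  ring_nf
  field_simp

/-- Near the edge of its support, `φ` is globally bounded by its leading power. -/
lemma KernelCondition.exists_bound_edge (hφ : KernelCondition φ A α) :
    ∃ C : ℝ, 0 ≤ C ∧ ∀ u, 0 < u → |φ (1 - u)| ≤ C * u ^ α := by
  obtain ⟨K, hK⟩ := hφ.bounded
  have hK0 : 0 ≤ K := (abs_nonneg _).trans (hK 0)
  have hev := hφ.expansion_at_one.def one_pos
  obtain ⟨δ, hδ, hδu⟩ := mem_nhdsGT_iff_exists_Ioo_subset.1 hev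
  rw [Set.mem_Ioi] at hδ
  -- The first constant serves near the edge, by the expansion; the second serves for `u ≥ δ`, where
  -- `u ^ α ≥ δ ^ α` because `α ≥ 0`.
  refine ⟨max (|A| + 1) (K / δ ^ α), le_max_of_le_left (by positivity), fun u hu => ?_⟩
  have hua : 0 ≤ u ^ α := Real.rpow_nonneg hu.le _
  rcases lt_or_ge u δ with hlt | hge
  · have h1 : |φ (1 - u) - A * u ^ α| ≤ u ^ α := by
      have := hδu (show u ∈ Set.Ioo 0 δ from ⟨hu, hlt⟩)
      simpa [abs_of_nonneg hua] using this
    have h2 : |φ (1 - u)| ≤ (|A| + 1) * u ^ α := by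
      have h3 := abs_add_le (φ (1 - u) - A * u ^ α) (A * u ^ α)
      rw [sub_add_cancel, abs_mul, abs_of_nonneg hua] at h3
      linarith
    exact h2.trans (mul_le_mul_of_nonneg_right (le_max_left _ _) hua)
  · have hδa : 0 < δ ^ α := Real.rpow_pos_of_pos hδ _
    have h1 : δ ^ α ≤ u ^ α := Real.rpow_le_rpow hδ.le hge hφ.exponent_nonneg
    calc |φ (1 - u)| ≤ K := hK _
      _ = K / δ ^ α * δ ^ α := by field_simp
      _ ≤ K / δ ^ α * u ^ α := by gcongr
      _ ≤ _ := mul_le_mul_of_nonneg_right (le_max_right _ _) hua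

lemma integrableOn_rpow_mul_exp_neg {a b : ℝ} (ha : 0 ≤ a) (hb : 0 < b) :
    IntegrableOn (fun v : ℝ => v ^ a * Real.exp (-(b * v))) (Set.Ioi 0) := by
  simpa using integrableOn_rpow_mul_exp_neg_mul_rpow (p := 1) (s := a) (b := b) (by linarith)
    one_pos hb

/-- Where `h² v < 1`, the quadratic correction costs at most half of the decay `σ² v`, whence the
rate `σ² / 2`. The majorant is free of `h`, so it serves both dominated convergence and the uniform
bound. -/
lemma abs_edgeWeight_le {C : ℝ} (hC0 : 0 ≤ C) (hC : ∀ u, 0 < u → |φ (1 - u)| ≤ C * u ^ α)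
    (hh : 0 < h) {v : ℝ} (hv : 0 < v) :
    |edgeWeight σ φ h v / (h ^ 2) ^ α| ≤ C * (v ^ α * Real.exp (-(σ ^ 2 / 2 * v))) := by
  have hha : 0 < (h ^ 2) ^ α := Real.rpow_pos_of_pos (by positivity) _
  by_cases hlt : h ^ 2 * v < 1
  · rw [edgeWeight, if_pos hlt, abs_div, abs_mul, abs_of_pos hha, Real.abs_exp, div_le_iff₀ hha]
    have h1 := hC (h ^ 2 * v) (by positivity)
    rw [Real.mul_rpow (by positivity) hv.le] at h1
    have h2 : -(σ ^ 2 * v) + σ ^ 2 * (h ^ 2 * v) * v / 2 ≤ -(σ ^ 2 / 2 * v) := by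
      have : σ ^ 2 * (h ^ 2 * v) * v ≤ σ ^ 2 * 1 * v := by gcongr
      linarith
    calc _ ≤ C * ((h ^ 2) ^ α * v ^ α) * Real.exp (-(σ ^ 2 / 2 * v)) := by gcongr
      _ = _ := by ring
  · rw [edgeWeight, if_neg hlt, zero_div, abs_zero]
    positivity

lemma tendsto_edgeWeight (hφ : KernelCondition φ A α) {h : ℕ → ℝ} (hpos : ∀ n, 0 < h n)
    (hlim : Tendsto h atTop (𝓝 0)) {v : ℝ} (hv : 0 < v) :
    Tendsto (fun n => edgeWeight σ φ (h n) v / (h n ^ 2) ^ α) atTop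
      (𝓝 (A * (v ^ α * Real.exp (-(σ ^ 2 * v))))) := by
  have hu : Tendsto (fun n => h n ^ 2 * v) atTop (𝓝 0) := by
    simpa using (hlim.pow 2).mul_const v
  have hupos : ∀ n, 0 < h n ^ 2 * v := fun n => by have := hpos n; positivity
  have hu' : Tendsto (fun n => h n ^ 2 * v) atTop (𝓝[>] 0) :=
    tendsto_nhdsWithin_iff.2 ⟨hu, Eventually.of_forall hupos⟩
  have h1 := hφ.expansion_at_one.tendsto_div_nhds_zero.comp hu'
  have h2 : Tendsto (fun n => Real.exp (-(σ ^ 2 * v) + σ ^ 2 * (h n ^ 2 * v) * v / 2)) atTop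
      (𝓝 (Real.exp (-(σ ^ 2 * v)))) := by
    refine (Real.continuous_exp.tendsto _).comp ?_
    simpa using (((hu.const_mul (σ ^ 2)).mul_const v).div_const 2).const_add (-(σ ^ 2 * v))
  have h3 := (((h1.add_const A).mul_const (v ^ α)).mul h2)
  rw [zero_add, mul_assoc] at h3
  refine h3.congr' ?_
  filter_upwards [hu.eventually_lt_const one_pos] with n hn
  have hha : 0 < (h n ^ 2) ^ α := Real.rpow_pos_of_pos (by have := hpos n; positivity) _
  have hva : 0 < v ^ α := Real.rpow_pos_of_pos hv _
  rw [edgeWeight, if_pos hn, Function.comp_apply, Real.mul_rpow (by positivity) hv.le]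
  field_simp
  ring

/-- The leading order of the normalised deconvolution kernel is `c cos (y / h)`. -/
lemma tendsto_integral_edge (hφ : KernelCondition φ A α) (hσ : 0 < σ) {h : ℕ → ℝ}
    (hpos : ∀ n, 0 < h n) (hlim : Tendsto h atTop (𝓝 0)) (y : ℝ) :
    Tendsto (fun n => (∫ v in Set.Ioi 0, edgeWeight σ φ (h n) v / (h n ^ 2) ^ α *
        Real.cos ((1 - h n ^ 2 * v) * (y / h n)))
      - A * ((1 / σ ^ 2) ^ (α + 1) * Real.Gamma (α + 1)) * Real.cos (y / h n)) atTop (𝓝 0) := by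
  obtain ⟨C, hC0, hC⟩ := hφ.exists_bound_edge
  have hα := hφ.exponent_nonneg
  have hσ2 : 0 < σ ^ 2 := by positivity
  have hint1 := (integrableOn_rpow_mul_exp_neg hα (half_pos hσ2)).const_mul C
  have hint2 := (integrableOn_rpow_mul_exp_neg hα hσ2).const_mul A
  have hmeas : ∀ n, AEStronglyMeasurable (fun v => edgeWeight σ φ (h n) v / (h n ^ 2) ^ α *
      Real.cos ((1 - h n ^ 2 * v) * (y / h n))) (volume.restrict (Set.Ioi 0)) := fun n => by
    have := measurable_edgeWeight (σ := σ) (h := h n) hφ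
    exact Measurable.aestronglyMeasurable (by fun_prop)
  have hle : ∀ n v, 0 < v → |edgeWeight σ φ (h n) v / (h n ^ 2) ^ α *
      Real.cos ((1 - h n ^ 2 * v) * (y / h n))| ≤ C * (v ^ α * Real.exp (-(σ ^ 2 / 2 * v))) :=
    fun n v hv => by
      rw [abs_mul]
      exact (mul_le_of_le_one_right (abs_nonneg _) (Real.abs_cos_le_one _)).trans
        (abs_edgeWeight_le hC0 hC (hpos n) hv)
  have hle2 : ∀ n (v : ℝ), |A * (v ^ α * Real.exp (-(σ ^ 2 * v))) * Real.cos (y / h n)|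
      ≤ |A * (v ^ α * Real.exp (-(σ ^ 2 * v)))| := fun n v => by
    rw [abs_mul]
    exact mul_le_of_le_one_right (abs_nonneg _) (Real.abs_cos_le_one _)
  have hGamma : ∫ v in Set.Ioi (0 : ℝ), v ^ α * Real.exp (-(σ ^ 2 * v))
      = (1 / σ ^ 2) ^ (α + 1) * Real.Gamma (α + 1) := by
    simpa using Real.integral_rpow_mul_exp_neg_mul_Ioi (a := α + 1) (r := σ ^ 2)
      (by linarith) hσ2
  have hrw : ∀ n, (∫ v in Set.Ioi 0, edgeWeight σ φ (h n) v / (h n ^ 2) ^ α *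
        Real.cos ((1 - h n ^ 2 * v) * (y / h n)))
      - A * ((1 / σ ^ 2) ^ (α + 1) * Real.Gamma (α + 1)) * Real.cos (y / h n)
      = ∫ v in Set.Ioi 0, (edgeWeight σ φ (h n) v / (h n ^ 2) ^ α *
        Real.cos ((1 - h n ^ 2 * v) * (y / h n))
          - A * (v ^ α * Real.exp (-(σ ^ 2 * v))) * Real.cos (y / h n)) := fun n => by
    rw [integral_sub (hint1.mono' (hmeas n) ((ae_restrict_iff' measurableSet_Ioi).2
        (ae_of_all _ fun v hv => hle n v hv))) (hint2.mul_const _), integral_mul_const,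
      integral_const_mul, hGamma]
  simp_rw [hrw]
  have hmeas2 : ∀ n, AEStronglyMeasurable (fun v => edgeWeight σ φ (h n) v / (h n ^ 2) ^ α *
        Real.cos ((1 - h n ^ 2 * v) * (y / h n))
          - A * (v ^ α * Real.exp (-(σ ^ 2 * v))) * Real.cos (y / h n))
      (volume.restrict (Set.Ioi 0)) :=
    fun n => (hmeas n).sub (hint2.mul_const _).aestronglyMeasurable
  rw [show 𝓝 (0 : ℝ) = 𝓝 (∫ _ in Set.Ioi (0 : ℝ), (0 : ℝ)) by simp]
  refine tendsto_integral_of_dominated_convergence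
    (fun v => C * (v ^ α * Real.exp (-(σ ^ 2 / 2 * v)))
      + |A * (v ^ α * Real.exp (-(σ ^ 2 * v)))|)
    hmeas2 (hint1.add hint2.abs)
    (fun n => (ae_restrict_iff' measurableSet_Ioi).2 (ae_of_all _ fun v hv =>
      (norm_sub_le _ _).trans (add_le_add (hle n v hv) (hle2 n v))))
    ((ae_restrict_iff' measurableSet_Ioi).2 (ae_of_all _ fun v hv => ?_))
  have hD := tendsto_edgeWeight (σ := σ) hφ hpos hlim hv
  set L := A * (v ^ α * Real.exp (-(σ ^ 2 * v))) with hL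
  -- The two phases differ by `h v y`, which tends to `0` although each may diverge.
  have hcos : Tendsto (fun n => Real.cos ((1 - h n ^ 2 * v) * (y / h n)) - Real.cos (y / h n))
      atTop (𝓝 0) := by
    have hb : Tendsto (fun n => |h n * (v * y)|) atTop (𝓝 0) := by
      simpa using (hlim.mul_const (v * y)).abs
    refine squeeze_zero_norm (fun n => ?_) hb
    refine (Real.abs_cos_sub_cos_le _ _).trans_eq ?_
    have := (hpos n).ne'
    rw [← abs_neg]
    congr 1
    field_simp
    ring
  have h1 : Tendsto (fun n => (edgeWeight σ φ (h n) v / (h n ^ 2) ^ α - L) *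
      Real.cos ((1 - h n ^ 2 * v) * (y / h n))) atTop (𝓝 0) := by
    refine squeeze_zero_norm (fun n => ?_) (by simpa using (hD.sub_const L).norm)
    rw [norm_mul]
    exact mul_le_of_le_one_right (norm_nonneg _) (Real.abs_cos_le_one _)
  have h2 := h1.add (hcos.const_mul L)
  rw [mul_zero, add_zero] at h2
  refine h2.congr fun n => ?_
  ring

lemma exists_bound_integral_edge (hφ : KernelCondition φ A α) (hσ : 0 < σ) :
    ∃ C : ℝ, ∀ h y, 0 < h → |∫ v in Set.Ioi 0, edgeWeight σ φ h v / (h ^ 2) ^ α *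
        Real.cos ((1 - h ^ 2 * v) * (y / h))| ≤ C := by
  obtain ⟨C, hC0, hC⟩ := hφ.exists_bound_edge
  have hint := (integrableOn_rpow_mul_exp_neg hφ.exponent_nonneg
    (half_pos (show 0 < σ ^ 2 by positivity))).const_mul C
  refine ⟨∫ v in Set.Ioi 0, C * (v ^ α * Real.exp (-(σ ^ 2 / 2 * v))), fun h y hh => ?_⟩
  rw [← Real.norm_eq_abs]
  refine norm_integral_le_of_norm_le hint
    ((ae_restrict_iff' measurableSet_Ioi).2 (ae_of_all _ fun v hv => ?_))
  rw [norm_mul]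
  exact (mul_le_of_le_one_right (norm_nonneg _) (Real.abs_cos_le_one _)).trans
    (abs_edgeWeight_le hC0 hC hh hv)

end Edge

/-! ### The normalised kernel. -/

section Normalised

variable {p σ : ℝ} {φ : ℝ → ℝ} {A α : ℝ}

/-- In `h ^ (1 + 2α)`, one factor `h` is the Jacobian of the substitution and `(h²) ^ α` is the
scale of `φ` at the edge. -/
lemma deconvKernel_div_eq (hφ : KernelCondition φ A α) {h : ℝ} (hh : 0 < h) (y : ℝ) :
    deconvKernel p σ φ h y / (h ^ (1 + 2 * α) * Real.exp (σ ^ 2 / (2 * h ^ 2))) =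
      1 / (Real.pi * (1 - p)) * ∫ v in Set.Ioi 0, edgeWeight σ φ h v / (h ^ 2) ^ α *
        Real.cos ((1 - h ^ 2 * v) * (y / h)) := by
  have hpow : h ^ (1 + 2 * α) = h * (h ^ 2) ^ α := by
    rw [Real.rpow_add hh, Real.rpow_one, Real.rpow_mul hh.le, Real.rpow_two]
  have hha : 0 < (h ^ 2) ^ α := Real.rpow_pos_of_pos (by positivity) _
  simp_rw [div_mul_eq_mul_div]
  rw [deconvKernel_eq_edge hφ hh, hpow, integral_div]
  set J := ∫ v in Set.Ioi 0, edgeWeight σ φ h v * Real.cos ((1 - h ^ 2 * v) * (y / h))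
  field_simp

lemma exists_bound_deconvKernel_div (hφ : KernelCondition φ A α) (hσ : 0 < σ) :
    ∃ C : ℝ, ∀ h y, 0 < h →
      |deconvKernel p σ φ h y / (h ^ (1 + 2 * α) * Real.exp (σ ^ 2 / (2 * h ^ 2)))| ≤ C := by
  obtain ⟨C, hC⟩ := exists_bound_integral_edge hφ hσ
  refine ⟨|1 / (Real.pi * (1 - p))| * C, fun h y hh => ?_⟩
  rw [deconvKernel_div_eq hφ hh, abs_mul]
  exact mul_le_mul_of_nonneg_left (hC h y hh) (abs_nonneg _)

lemma tendsto_deconvKernel_div_sub (hφ : KernelCondition φ A α) (hσ : 0 < σ) {h : ℕ → ℝ}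
    (hpos : ∀ n, 0 < h n) (hlim : Tendsto h atTop (𝓝 0)) (y : ℝ) :
    Tendsto (fun n => deconvKernel p σ φ (h n) y /
        (h n ^ (1 + 2 * α) * Real.exp (σ ^ 2 / (2 * h n ^ 2)))
      - A / (Real.pi * (1 - p)) * ((1 / σ ^ 2) ^ (α + 1) * Real.Gamma (α + 1)) *
        Real.cos ((h n)⁻¹ * y)) atTop (𝓝 0) := by
  have := (tendsto_integral_edge hφ hσ hpos hlim y).const_mul (1 / (Real.pi * (1 - p)))
  rw [mul_zero] at this
  refine this.congr fun n => ?_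
  rw [deconvKernel_div_eq hφ (hpos n), inv_mul_eq_div]
  ring

end Normalised

/-! ### Averaging of the oscillating phase. -/

/-- The Gaussian component forces the characteristic function to vanish at infinity. -/
lemma tendsto_charFun_map_add_gaussian {Ω : Type*} [MeasurableSpace Ω] {P : Measure Ω}
    [IsProbabilityMeasure P] {Y Z : Ω → ℝ} {σ : ℝ} (hσ : 0 < σ) (hY : AEMeasurable Y P)
    (hZ : HasLaw Z (gaussianReal 0 1) P) (hind : IndepFun Y Z P) :
    Tendsto (charFun (P.map fun ω => Y ω + σ * Z ω)) atTop (𝓝 0) := by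
  have hind' : IndepFun Y (fun ω => σ * Z ω) P :=
    hind.comp measurable_id (measurable_const_mul σ)
  rw [hind'.charFun_map_fun_add_eq_mul hY (hZ.aemeasurable.const_mul σ)]
  have hle : ∀ t, ‖(charFun (P.map Y) * charFun (P.map fun ω => σ * Z ω)) t‖
      ≤ Real.exp (-((σ * t) ^ 2 / 2)) := by
    intro t
    have := Measure.isProbabilityMeasure_map hY
    rw [Pi.mul_apply, norm_mul, charFun_map_mul_comp hZ.aemeasurable, hZ.map_eq,
      charFun_gaussianReal, Complex.norm_exp]
    refine (mul_le_of_le_one_left (Real.exp_pos _).le (norm_charFun_le_one t)).trans_eq ?_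
    congr 1
    simp [pow_two]
  refine squeeze_zero_norm hle ?_
  refine Real.tendsto_exp_neg_atTop_nhds_zero.comp ?_
  exact ((tendsto_pow_atTop two_ne_zero).comp (tendsto_id.const_mul_atTop hσ)).atTop_div_const
    two_pos

section Oscillation

variable {ν : Measure ℝ} [IsProbabilityMeasure ν]

/-- The shift by `x` only multiplies the characteristic function by a unimodular factor, so the
bound is uniform in `x`. -/
lemma abs_integral_cos_le (s x : ℝ) :
    |∫ y, Real.cos (s * (y - x)) ∂ν| ≤ ‖charFun ν s‖ := by
  have hint : Integrable (fun y : ℝ => Complex.exp (s * y * Complex.I)) ν :=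
    Integrable.of_bound (by fun_prop) 1 (ae_of_all _ fun y => by
      rw [← Complex.ofReal_mul, Complex.norm_exp_ofReal_mul_I])
  have heq : ∫ y, Real.cos (s * (y - x)) ∂ν
      = (Complex.exp ((-(s * x) : ℝ) * Complex.I) * charFun ν s).re := by
    rw [charFun_apply_real, ← integral_const_mul]
    refine Eq.trans (integral_congr_ae (ae_of_all _ fun y => ?_))
      (integral_re (𝕜 := ℂ) (hint.const_mul _))
    simp only [← Complex.exp_add, RCLike.re_to_complex]
    rw [← Complex.exp_ofReal_mul_I_re]
    congr 2
    push_cast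
    ring
  rw [heq]
  refine (Complex.abs_re_le_norm _).trans_eq ?_
  rw [norm_mul, Complex.norm_exp_ofReal_mul_I, one_mul]

lemma tendsto_integral_cos (hν : Tendsto (charFun ν) atTop (𝓝 0)) {s : ℕ → ℝ}
    (hs : Tendsto s atTop atTop) (x : ℝ) :
    Tendsto (fun n => ∫ y, Real.cos (s n * (y - x)) ∂ν) atTop (𝓝 0) :=
  squeeze_zero_norm (fun n => abs_integral_cos_le (s n) x) (by simpa using (hν.comp hs).norm)

/-- By the double-angle formula, `cos²` is `1/2` plus half a cosine of frequency `2 s`, which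
averages out as well. -/
lemma tendsto_integral_cos_sq (hν : Tendsto (charFun ν) atTop (𝓝 0)) {s : ℕ → ℝ}
    (hs : Tendsto s atTop atTop) (x : ℝ) :
    Tendsto (fun n => ∫ y, Real.cos (s n * (y - x)) ^ 2 ∂ν) atTop (𝓝 (1 / 2)) := by
  have h2 := tendsto_integral_cos hν (hs.const_mul_atTop (two_pos : (0 : ℝ) < 2)) x
  have h3 := (h2.div_const 2).const_add (1 / 2)
  rw [zero_div, add_zero] at h3
  refine h3.congr fun n => ?_
  have hint : Integrable (fun y => Real.cos (2 * s n * (y - x))) ν :=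
    Integrable.of_bound (by fun_prop) 1 (ae_of_all _ fun y => Real.abs_cos_le_one _)
  simp_rw [Real.cos_sq, ← mul_assoc]
  rw [integral_add (integrable_const _) (hint.div_const _)]
  simp [integral_div]

/-- First and second moments of bounded functions asymptotic to `c cos (s (y - x))`, `s → ∞`. -/
lemma tendsto_integral_of_sub_cos (hν : Tendsto (charFun ν) atTop (𝓝 0)) {s : ℕ → ℝ}
    (hs : Tendsto s atTop atTop) {x c C : ℝ} {K : ℕ → ℝ → ℝ} (hK : ∀ n, Measurable (K n))
    (hC : ∀ n y, |K n y| ≤ C)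
    (hlim : ∀ y, Tendsto (fun n => K n y - c * Real.cos (s n * (y - x))) atTop (𝓝 0)) :
    Tendsto (fun n => ∫ y, K n y ∂ν) atTop (𝓝 0) ∧
      Tendsto (fun n => ∫ y, K n y ^ 2 ∂ν) atTop (𝓝 (c ^ 2 / 2)) := by
  set k : ℕ → ℝ → ℝ := fun n y => c * Real.cos (s n * (y - x)) with hk
  have hkm : ∀ n, Measurable (k n) := fun n => by fun_prop
  have hkle : ∀ n y, |k n y| ≤ |c| := fun n y => by
    rw [hk, abs_mul]
    exact mul_le_of_le_one_right (abs_nonneg _) (Real.abs_cos_le_one _)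
  have hint : ∀ {g : ℝ → ℝ} {M : ℝ}, Measurable g → (∀ y, |g y| ≤ M) → Integrable g ν :=
    fun hg hM => Integrable.of_bound hg.aestronglyMeasurable _ (ae_of_all _ hM)
  have hsq : ∀ {g : ℝ → ℝ} {M : ℝ}, (∀ y, |g y| ≤ M) → ∀ y, |g y ^ 2| ≤ M ^ 2 :=
    fun hM y => by rw [abs_pow]; exact pow_le_pow_left₀ (abs_nonneg _) (hM y) 2
  have hdiff : ∀ n y, |K n y - k n y| ≤ C + |c| := fun n y =>
    (abs_sub _ _).trans (add_le_add (hC n y) (hkle n y))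
  constructor
  · have h1 : Tendsto (fun n => ∫ y, (K n y - k n y) ∂ν) atTop (𝓝 (∫ _, (0 : ℝ) ∂ν)) :=
      tendsto_integral_of_dominated_convergence (fun _ => C + |c|)
        (fun n => ((hK n).sub (hkm n)).aestronglyMeasurable) (integrable_const _)
        (fun n => ae_of_all _ (hdiff n)) (ae_of_all _ hlim)
    have h2 := h1.add ((tendsto_integral_cos hν hs x).const_mul c)
    simp only [integral_zero, mul_zero, add_zero] at h2
    refine h2.congr fun n => ?_
    rw [integral_sub (hint (hK n) (hC n)) (hint (hkm n) (hkle n)), ← integral_const_mul,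
      sub_add_cancel]
  · have h1 : Tendsto (fun n => ∫ y, (K n y ^ 2 - k n y ^ 2) ∂ν) atTop (𝓝 (∫ _, (0 : ℝ) ∂ν)) := by
      refine tendsto_integral_of_dominated_convergence (fun _ => C ^ 2 + |c| ^ 2)
        (fun n => (((hK n).pow_const 2).sub ((hkm n).pow_const 2)).aestronglyMeasurable)
        (integrable_const _) (fun n => ae_of_all _ fun y => ?_) (ae_of_all _ fun y => ?_)
      · exact (abs_sub _ _).trans (add_le_add (hsq (hC n) y) (hsq (hkle n) y))
      · have hb : Tendsto (fun n => |K n y - k n y| * (C + |c|)) atTop (𝓝 0) := by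
          simpa using (hlim y).abs.mul_const (C + |c|)
        refine squeeze_zero_norm (fun n => ?_) hb
        rw [Real.norm_eq_abs, sq_sub_sq, abs_mul, mul_comm]
        gcongr
        exact (abs_add_le _ _).trans (add_le_add (hC n y) (hkle n y))
    have h2 := h1.add ((tendsto_integral_cos_sq hν hs x).const_mul (c ^ 2))
    rw [integral_zero, zero_add, mul_one_div] at h2
    refine h2.congr fun n => ?_
    rw [integral_sub (hint ((hK n).pow_const 2) (hsq (hC n)))
      (hint ((hkm n).pow_const 2) (hsq (hkle n))), ← integral_const_mul]
    simp only [hk, mul_pow, sub_add_cancel]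

end Oscillation

/-! ### Assembly of the limit theorem. -/

theorem theorem2p2
    {Ω₀ Ω : Type*} [MeasurableSpace Ω₀] [MeasurableSpace Ω]
    (P₀ : Measure Ω₀) [IsProbabilityMeasure P₀] (P : Measure Ω) [IsProbabilityMeasure P]
    (p σ : ℝ) (hp₀ : 0 ≤ p) (hp₁ : p < 1) (hσ : 0 < σ)
    -- the population variables, with `Y = U V` and `X = Y + σ Z`
    (f : ℝ → ℝ) (U V Z : Ω₀ → ℝ) (hmodel : IsAtomicModel P₀ p f U V Z)
    -- the observations: i.i.d. copies of `X`
    (X : ℕ → Ω → ℝ) (hindep : iIndepFun X P)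
    (hident : ∀ j, IdentDistrib (X j) (fun ω => U ω * V ω + σ * Z ω) P P₀)
    -- `φ_f` is integrable and `E[X²] < ∞`
    (hφf : Integrable (charFun (P₀.map V)) volume)
    (hX2 : Integrable (fun ω => (U ω * V ω + σ * Z ω) ^ 2) P₀)
    (φw : ℝ → ℝ) (A α : ℝ) (hkernel : KernelCondition φw A α)
    (h : ℕ → ℝ) (hpos : ∀ n, 0 < h n) (hlim : Tendsto h atTop (𝓝 0))
    (x : ℝ) :
    -- the estimator is well defined, real valued, and has a mean
    (∀ n ω, Integrable (estimatorIntegrand p σ φw (fun j => X j ω) n (h n) x) volume ∧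
      (deconvEstimator p σ φw (fun j => X j ω) n (h n) x).im = 0) ∧
    (∀ n, Integrable (fun ω => deconvEstimator p σ φw (fun j => X j ω) n (h n) x) P) ∧
    -- asymptotic normality
    TendstoInDistribution
      (fun (n : ℕ) (ω : Ω) =>
        √(n : ℝ) / (h n ^ (1 + 2 * α) * Real.exp (σ ^ 2 / (2 * h n ^ 2))) *
          ((deconvEstimator p σ φw (fun j => X j ω) n (h n) x).re -
            ∫ ω', (deconvEstimator p σ φw (fun j => X j ω') n (h n) x).re ∂P))
      atTop (id : ℝ → ℝ) (fun _ => P)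
      (gaussianReal 0
        (A ^ 2 / (2 * Real.pi ^ 2 * (1 - p) ^ 2) * (1 / σ ^ 2) ^ (2 + 2 * α) *
          Real.Gamma (α + 1) ^ 2).toNNReal) := by
  have hYm : AEMeasurable (fun ω => U ω * V ω) P₀ :=
    hmodel.law_U.aemeasurable.mul hmodel.law_V.aemeasurable
  have hXm : AEMeasurable (fun ω => U ω * V ω + σ * Z ω) P₀ :=
    hYm.add (hmodel.law_Z.aemeasurable.const_mul σ)
  set ν : Measure ℝ := P₀.map (fun ω => U ω * V ω + σ * Z ω) with hν
  have : IsProbabilityMeasure ν := Measure.isProbabilityMeasure_map hXm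
  have hlaw : ∀ j, HasLaw (X j) ν P := fun j => ⟨(hident j).aemeasurable_fst, (hident j).map_eq⟩
  have hchar : Tendsto (charFun ν) atTop (𝓝 0) :=
    tendsto_charFun_map_add_gaussian hσ hYm hmodel.law_Z hmodel.indep_Y_Z
  have heq := fun (n : ℕ) (ω : Ω) =>
    deconvEstimator_eq (σ := σ) hkernel hp₁ (hpos n) (fun j => X j ω) n x
  have hcont := fun n => continuous_deconvKernel (σ := σ) hkernel hp₁ (hpos n)
  set a : ℕ → ℝ := fun n => h n ^ (1 + 2 * α) * Real.exp (σ ^ 2 / (2 * h n ^ 2)) with ha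
  have hapos : ∀ n, 0 < a n := fun n =>
    mul_pos (Real.rpow_pos_of_pos (hpos n) _) (Real.exp_pos _)
  set K : ℕ → ℝ → ℝ := fun n y => deconvKernel p σ φw (h n) (y - x) / a n with hK
  have hKm : ∀ n, Measurable (K n) := fun n => by
    have := (hcont n).measurable
    fun_prop
  obtain ⟨C, hC⟩ := exists_bound_deconvKernel_div (p := p) hkernel hσ
  have hKle : ∀ n y, |K n y| ≤ C := fun n y => hC (h n) (y - x) (hpos n)
  have hKint : ∀ n, Integrable (K n) ν := fun n =>
    Integrable.of_bound (hKm n).aestronglyMeasurable C (ae_of_all _ (hKle n))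
  have hKX : ∀ n j, Integrable (fun ω => K n (X j ω)) P := fun n j =>
    Integrable.of_bound ((hKm n).comp_aemeasurable (hlaw j).aemeasurable).aestronglyMeasurable C
      (ae_of_all _ fun ω => hKle n _)
  have hre : ∀ n ω, (deconvEstimator p σ φw (fun j => X j ω) n (h n) x).re
      = a n * ((1 / (n : ℝ)) * ∑ j ∈ Finset.range n, K n (X j ω))
        - p * deconvKernel p 0 φw (h n) (-x) := by
    intro n ω
    have : ∀ y, deconvKernel p σ φw (h n) (y - x) = a n * K n y := fun y =>
      (mul_div_cancel₀ _ (hapos n).ne').symm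
    rw [heq, Complex.ofReal_re]
    simp_rw [this, ← Finset.mul_sum]
    ring
  have hreint : ∀ n, Integrable
      (fun ω => (deconvEstimator p σ φw (fun j => X j ω) n (h n) x).re) P := fun n => by
    simp_rw [hre]
    exact (((integrable_finsetSum _ fun j _ => hKX n j).const_mul _).const_mul _).sub
      (integrable_const _)
  refine ⟨fun n ω => ⟨integrable_estimatorIntegrand hkernel hp₁ (hpos n) _ n x, ?_⟩,
    fun n => ?_, ?_⟩
  · rw [heq, Complex.ofReal_im]
  · refine (hreint n).ofReal.congr (ae_of_all _ fun ω => ?_)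
    simp only [heq, Complex.ofReal_re]
    rfl
  have hs : Tendsto (fun n => (h n)⁻¹) atTop atTop :=
    tendsto_inv_nhdsGT_zero.comp
      (tendsto_nhdsWithin_iff.2 ⟨hlim, Eventually.of_forall hpos⟩)
  set c : ℝ := A / (Real.pi * (1 - p)) * ((1 / σ ^ 2) ^ (α + 1) * Real.Gamma (α + 1)) with hc
  obtain ⟨hmean, hsq⟩ := tendsto_integral_of_sub_cos hchar hs hKm hKle
    (fun y => tendsto_deconvKernel_div_sub (p := p) hkernel hσ hpos hlim (y - x))
  have hvar : A ^ 2 / (2 * Real.pi ^ 2 * (1 - p) ^ 2) * (1 / σ ^ 2) ^ (2 + 2 * α) *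
      Real.Gamma (α + 1) ^ 2 = c ^ 2 / 2 := by
    have hpow : (1 / σ ^ 2) ^ (2 + 2 * α) = ((1 / σ ^ 2) ^ (α + 1)) ^ 2 := by
      rw [← Real.rpow_mul_natCast (by positivity)]
      congr 1
      push_cast
      ring
    have hp' : 1 - p ≠ 0 := (sub_pos.2 hp₁).ne'
    rw [hpow, hc]
    field_simp
  have hcentred : ∀ n, ∫ y, (K n y - ∫ z, K n z ∂ν) ∂ν = 0 := fun n => by
    rw [integral_sub (hKint n) (integrable_const _), integral_const]
    simp
  have hmeanle : ∀ n, |∫ z, K n z ∂ν| ≤ C := fun n => by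
    simpa using norm_integral_le_of_norm_le_const (μ := ν) (f := K n) (ae_of_all _ (hKle n))
  have hclt := tendstoInDistribution_inv_sqrt_mul_sum_of_bounded hindep hlaw
    (ξ := fun n y => K n y - ∫ z, K n z ∂ν) (C := C + C) (v := c ^ 2 / 2)
    (fun n => (hKm n).sub_const _)
    (fun n y => (abs_sub _ _).trans (add_le_add (hKle n y) (hmeanle n)))
    hcentred
    (by
      -- The variance is the second moment minus the squared mean; the means tend to `0`, so
      -- centring leaves the limit `c² / 2` unchanged.
      have h1 := hsq.sub (hmean.pow 2)
      rw [zero_pow two_ne_zero, sub_zero] at h1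
      refine h1.congr fun n => ?_
      have hv := variance_eq_sub (μ := ν) (X := K n)
        (MemLp.of_bound (hKm n).aestronglyMeasurable C (ae_of_all _ (hKle n)))
      rw [variance_eq_integral (hKm n).aemeasurable] at hv
      exact hv.symm)
  rw [hvar]
  refine hclt.congr (fun n => ae_of_all _ fun ω => ?_) (ae_of_all _ fun _ => rfl)
  have hEK : ∀ j, ∫ ω, K n (X j ω) ∂P = ∫ z, K n z ∂ν := fun j =>
    (hlaw j).integral_comp (hKm n).aestronglyMeasurable
  have hE : ∫ ω', (deconvEstimator p σ φw (fun j => X j ω') n (h n) x).re ∂P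
      = a n * ((1 / (n : ℝ)) * (n * ∫ z, K n z ∂ν)) - p * deconvKernel p 0 φw (h n) (-x) := by
    simp_rw [hre]
    rw [integral_sub (((integrable_finsetSum _ fun j _ => hKX n j).const_mul _).const_mul _)
      (integrable_const _), integral_const_mul, integral_const_mul,
      integral_finsetSum _ fun j _ => hKX n j]
    simp [hEK]
  beta_reduce
  rw [hE, hre]
  simp only [Finset.sum_sub_distrib, Finset.sum_const, Finset.card_range, nsmul_eq_mul]
  have han := (hapos n).ne'
  change _ = √(n : ℝ) / a n * _
  -- This also holds at `n = 0`, where both sides are `0`, so no case split is needed.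
  have hroot : √(n : ℝ) * (1 / (n : ℝ)) = (√(n : ℝ))⁻¹ := by
    rw [mul_one_div, Real.sqrt_div_self]
  rw [← hroot]
  field_simp
  ring
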